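/- Let $D=\{z\in\mathbb C:|z|<1\}$, $\overline D=\{z\in\mathbb C:|z|\le 1\}$ and $T=\{z\in\mathbb C:|z|=1\}$. Let $\overline{\mathbb C}=\mathbb C\cup\mathbb C^\infty$, where $\mathbb C^\infty=\{\infty e^{i\theta}:\theta\in\mathbb R\}$, with the metric $d(w_1,w_2)=|G(w_1)-G(w_2)|$, where $G(z)=\frac{z}{1+|z|}$ for $z\in\mathbb C$ and $G(\infty e^{i\theta})=e^{i\theta}$. Let $\overline A(D)$ be the set of all continuous functions $f:\overline D\to\overline{\mathbb C}$ of one of the following two types: (a) finite type: $f(D)\subset\mathbb C$ and $f|_D$ is holomorphic; (b) infinite type: $f(z)=\infty e^{i\theta(z)}$ for all $z\in\overline D$, where $\theta:\overline D\to\mathbb R$ is continuous on $\overline D$ and harmonic in $D$. Equip $\overline A(D)$ with the metric $\overline d(f,g)=\sup_{|z|\le 1}d(f(z),g(z))$. Let $\eta$ be a Hausdorff measure function, that is, a non-decreasing right-continuous function $\eta:[0,\infty)\to[0,\infty)$ with $\eta(0)=0$ and $\eta(t)>0$ for $t>0$, and let $$\Lambda_\eta(E)=\lim_{\delta\to0^+}\inf\Big\{\sum_{i}\eta(\operatorname{diam}A_i):E\subset\bigcup_i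 A_i,\ \operatorname{diam}A_i\le\delta\Big\}$$ (the infimum being over countable covers) be the corresponding Hausdorff measure. For $f\in\overline A(D)$ of finite type put $E_f=\{\zeta\in T: f(\zeta)\notin f(D)\}$. Then the set of all $f\in\overline A(D)$ of finite type such that $\Lambda_\eta(E_f)=0$ is a dense $G_\delta$ subset of $\overline A(D)$. -/

import Mathlib

open scoped NNReal ENNReal

noncomputable section

namespace ExtDisc

/-- The compactification `ℂ ∪ {∞ e^{iθ} : θ ∈ ℝ}` of the plane by a circle of points at infinity;
`inf u` is the point `∞ u`, for `u` unimodular. -/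
inductive CBar : Type
  | fin (z : ℂ) : CBar
  | inf (u : Circle) : CBar

namespace CBar

/-- The identification of the compactified plane with the closed unit disc:
`z ↦ z / (1 + |z|)` and `∞ e^{iθ} ↦ e^{iθ}`. -/
def toDisc : CBar → ℂ
  | fin z => z / (1 + ‖z‖ : ℝ)
  | inf u => u

theorem norm_toDisc_fin (z : ℂ) : ‖toDisc (fin z)‖ = ‖z‖ / (1 + ‖z‖) := by
  have h : (0 : ℝ) ≤ 1 + ‖z‖ := by positivity
  rw [toDisc, norm_div, Complex.norm_real, Real.norm_of_nonneg h]

theorem norm_toDisc_fin_lt_one (z : ℂ) : ‖toDisc (fin z)‖ < 1 := by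
  have h : (0 : ℝ) < 1 + ‖z‖ := by positivity
  rw [norm_toDisc_fin, div_lt_one h]
  linarith

theorem toDisc_injective : Function.Injective toDisc := by
  rintro (z | u) (w | v) h
  · have hz : (0 : ℝ) < 1 + ‖z‖ := by positivity
    have hw : (0 : ℝ) < 1 + ‖w‖ := by positivity
    have hn : ‖z‖ = ‖w‖ := by
      have := congrArg norm h
      rw [norm_toDisc_fin, norm_toDisc_fin, div_eq_div_iff hz.ne' hw.ne'] at this
      linarith
    have hc : ((1 + ‖w‖ : ℝ) : ℂ) ≠ 0 := by exact_mod_cast hw.ne'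
    simp only [toDisc, hn] at h
    rw [div_left_inj' hc] at h
    rw [h]
  · have := norm_toDisc_fin_lt_one z
    rw [h] at this
    exact absurd (Circle.norm_coe _) this.ne
  · have := norm_toDisc_fin_lt_one w
    rw [← h] at this
    exact absurd (Circle.norm_coe _) this.ne
  · simp only [toDisc] at h
    rw [Circle.coe_injective h]

/-- The metric `d(x, y) = |toDisc x - toDisc y|`, carried over from the closed unit disc. -/
instance : MetricSpace CBar :=
  MetricSpace.induced toDisc toDisc_injective inferInstance

theorem dist_def (x y : CBar) : dist x y = ‖toDisc x - toDisc y‖ :=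
  dist_eq_norm (toDisc x) (toDisc y)

end CBar

/-- The closed unit disc, as a compact metric space. -/
abbrev ClosedDisc : Type := Metric.closedBall (0 : ℂ) 1

/-- The open unit disc `D`, as a subset of the closed one. -/
def openDisc : Set ClosedDisc := {z | ‖(z : ℂ)‖ < 1}

/-- The unit circle `T`, as a subset of the closed disc. -/
def unitCircle : Set ClosedDisc := {z | ‖(z : ℂ)‖ = 1}

/-- Finite type: on the open disc, `f` takes finite values and is holomorphic. -/
def IsFiniteType (f : C(ClosedDisc, CBar)) : Prop :=
  ∃ g : ℂ → ℂ, DifferentiableOn ℂ g (Metric.ball 0 1) ∧ ∀ z ∈ openDisc, f z = CBar.fin (g z)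

/-- Infinite type: `f(z) = ∞ e^{iθ(z)}` on the closed disc, with `θ` real-valued, continuous on
the closed disc and harmonic in the open disc. -/
def IsInfiniteType (f : C(ClosedDisc, CBar)) : Prop :=
  ∃ θ : ℂ → ℝ, ContinuousOn θ (Metric.closedBall 0 1) ∧
    InnerProductSpace.HarmonicOnNhd θ (Metric.ball 0 1) ∧
    ∀ z : ClosedDisc, f z = CBar.inf (Circle.exp (θ z))

/-- The extended disc algebra. As a subspace of `C(ClosedDisc, CBar)` it carries the metric
`sup_{|z| ≤ 1} d(f z, g z)`, see `ABar.dist_eq_iSup`. -/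
abbrev ABar : Type := {f : C(ClosedDisc, CBar) // IsFiniteType f ∨ IsInfiniteType f}

theorem ABar.dist_eq_iSup (f g : ABar) : dist f g = ⨆ z : ClosedDisc, dist (f.1 z) (g.1 z) :=
  ContinuousMap.dist_eq_iSup

/-- The set of `ζ ∈ T` with `f(ζ) ∉ f(D)`, as a subset of the plane. -/
def exceptionalSet (f : C(ClosedDisc, CBar)) : Set ℂ :=
  (↑) '' {ζ : ClosedDisc | ζ ∈ unitCircle ∧ f ζ ∉ f '' openDisc}

/-- Hausdorff measure functions `η : [0, ∞) → [0, ∞)`: non-decreasing, right-continuous, zero at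
`0` and positive elsewhere. In particular `η(t) → 0` as `t → 0`. -/
structure IsHausdorffMeasureFunction (η : ℝ≥0 → ℝ≥0) : Prop where
  monotone : Monotone η
  rightContinuous : ∀ t, ContinuousWithinAt η (Set.Ici t) t
  zero : η 0 = 0
  pos : ∀ t, 0 < t → 0 < η t

/-- The Hausdorff measure `Λ_η` on the plane: the limit as `δ → 0` of the infimum of
`∑ η(diam Aᵢ)` over countable covers by sets of diameter at most `δ`. (The value of the gauge at
infinite diameter plays no role.) -/
def hausdorffMeasureOf (η : ℝ≥0 → ℝ≥0) : MeasureTheory.Measure ℂ :=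
  MeasureTheory.Measure.mkMetric fun t : ℝ≥0∞ => (η t.toNNReal : ℝ≥0∞)

end ExtDisc

end

/-!
The extended disc algebra contains the disc algebra, which is complete, as a dense subset: a
function of infinite type `∞ e^{i Re h}` is the limit of the functions `n e^{i h}`. So by Baire it
suffices to find countably many open sets of finite-type functions whose traces on the disc algebra
are dense. The `n`-th one asks for an open set `U` of `1 / n`-content at most `1 / n` such that
`f` is not constant and takes at each boundary point off `U` a value in `f(D)`.

This is an open condition because, by Hurwitz's theorem, an attained value of a nonconstant function
stays attained under perturbation, and the circle minus `U` is compact.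

For density, choose a fine net `t` on the circle and add to a function `P` of the disc algebra small
multiples of holomorphic bumps peaking sharply at the points of `t`. Near `j ∈ t` the sum covers a
fixed disc around `P(j)`, while off a small neighbourhood of `t` its boundary values differ little
from those of `P` and hence lie in one of these discs. Finite sets being null, the neighbourhood
may have arbitrarily small content.

The constants, which have no exceptional points but violate these conditions, are a `Gδ` set of
their own: they are closed among the functions of finite type.
-/

namespace ExtDisc

open MeasureTheory Metric Set Filter Topology

section Gauge

variable {X : Type*} [EMetricSpace X] {m : ℝ≥0∞ → ℝ≥0∞}

/-- The size-`r` approximation of the Hausdorff measure with gauge `m`, built from covers by sets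
of diameter at most `r`; it increases to `Measure.mkMetric m` as `r → 0`. -/
noncomputable def gaugeContent (m : ℝ≥0∞ → ℝ≥0∞) (r : ℝ≥0∞) : OuterMeasure X :=
  OuterMeasure.mkMetric'.pre (fun s => m (ediam s)) r

theorem gaugeContent_le {r : ℝ≥0∞} {s : Set X} (hs : ediam s ≤ r) :
    gaugeContent m r s ≤ m (ediam s) :=
  OuterMeasure.mkMetric'.pre_le hs

theorem exists_gaugeContent_thickening_le (hmono : MonotoneOn m (Iio ⊤))
    (hcont : ∀ t < ⊤, ContinuousWithinAt m (Ici t) t) {r c : ℝ≥0∞} {A : Set X}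
    (hA : ediam A < r) (hc : m (ediam A) < c) :
    ∃ δ > 0, gaugeContent m r (thickening δ A) ≤ c := by
  have hA_top : ediam A < ⊤ := hA.trans_le le_top
  have hdiam : Tendsto (fun δ : ℝ≥0 => ediam A + 2 * δ) (𝓝 0) (𝓝[≥] ediam A) := by
    refine tendsto_nhdsWithin_iff.2 ⟨?_, Eventually.of_forall fun δ => mem_Ici.2 le_self_add⟩
    have : Continuous fun δ : ℝ≥0 => ediam A + 2 * (δ : ℝ≥0∞) := by
      fun_prop (disch := simp)
    simpa using this.tendsto 0
  have hsmall : ∀ᶠ δ : ℝ≥0 in 𝓝 0, ediam A + 2 * δ < r ∧ m (ediam A + 2 * δ) < c :=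
    ((hdiam.mono_right nhdsWithin_le_nhds).eventually_lt_const hA).and
      (((hcont _ hA_top).tendsto.comp hdiam).eventually_lt_const hc)
  obtain ⟨δ, ⟨hδr, hδc⟩, hδ⟩ :=
    ((hsmall.filter_mono nhdsWithin_le_nhds).and (self_mem_nhdsWithin (s := Ioi 0))).exists
  have hle : ediam (thickening (δ : ℝ) A) ≤ ediam A + 2 * δ := ediam_thickening_le δ
  have hlt_top : ediam A + 2 * δ < ⊤ := hδr.trans_le le_top
  refine ⟨δ, NNReal.coe_pos.2 hδ, (gaugeContent_le (hle.trans hδr.le)).trans ?_⟩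
  exact (hmono (hle.trans_lt hlt_top) hlt_top hle).trans hδc.le

variable [MeasurableSpace X] [BorelSpace X]

theorem tendsto_gaugeContent (m : ℝ≥0∞ → ℝ≥0∞) (s : Set X) :
    Tendsto (fun n : ℕ => gaugeContent m (n : ℝ≥0∞)⁻¹ s) atTop (𝓝 (Measure.mkMetric m s)) := by
  rw [← OuterMeasure.coe_mkMetric]
  exact OuterMeasure.mkMetric'.tendsto_pre_nat _ s

theorem mkMetric_finset_eq_zero (hm : m 0 = 0) (F : Finset X) :
    Measure.mkMetric m (F : Set X) = 0 := by
  have hsingleton (x : X) : Measure.mkMetric m {x} = 0 := by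
    have hcontent (r : ℝ≥0∞) : gaugeContent m r {x} = 0 :=
      nonpos_iff_eq_zero.1 ((gaugeContent_le (by simp)).trans (by simp [hm]))
    exact tendsto_nhds_unique (tendsto_gaugeContent m _) (by simp [hcontent])
  rw [← biUnion_of_singleton (F : Set X), measure_biUnion_null_iff F.countable_toSet]
  exact fun x _ => hsingleton x

/-- The witness for small `r` is built from a cover at an intermediate scale `q < r`, each member
of which is thickened at a summable cost. -/
theorem exists_isOpen_gaugeContent_le (hmono : MonotoneOn m (Iio ⊤))
    (hcont : ∀ t < ⊤, ContinuousWithinAt m (Ici t) t) {E : Set X}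
    (hE : Measure.mkMetric m E = 0) {r : ℝ≥0∞} (hr : 0 < r) :
    ∃ U, IsOpen U ∧ E ⊆ U ∧ gaugeContent m r U ≤ r := by
  obtain ⟨q, hq, hqr⟩ := exists_between hr
  obtain ⟨a, ha, hsum⟩ := ENNReal.exists_pos_sum_of_countable' (tsub_pos_of_lt hqr).ne' ℕ
  obtain ⟨t, htE, htq, hcost⟩ : ∃ t : ℕ → Set X, E ⊆ ⋃ n, t n ∧ (∀ n, ediam (t n) ≤ q) ∧
      ∑' n, ⨆ _ : (t n).Nonempty, m (ediam (t n)) < q := by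
    rw [Measure.mkMetric_apply, ← nonpos_iff_eq_zero, iSup₂_le_iff] at hE
    simpa only [iInf_lt_iff, exists_prop] using (hE q hq).trans_lt hq
  have hthicken (n : ℕ) : ∃ δ > 0, gaugeContent m r (thickening δ (t n)) ≤
      (⨆ _ : (t n).Nonempty, m (ediam (t n))) + a n := by
    rcases (t n).eq_empty_or_nonempty with h | h
    · exact ⟨1, one_pos, by simp [h]⟩
    · simp only [h, iSup_pos]
      refine exists_gaugeContent_thickening_le hmono hcont ((htq n).trans_lt hqr)
        (ENNReal.lt_add_right ?_ (ha n).ne')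
      refine ne_top_of_le_ne_top (hcost.trans hqr).ne_top ?_
      exact (le_iSup_of_le h le_rfl).trans (ENNReal.le_tsum
        (f := fun n => ⨆ _ : (t n).Nonempty, m (ediam (t n))) n)
  choose δ hδ hδ_cost using hthicken
  refine ⟨⋃ n, thickening (δ n) (t n), isOpen_iUnion fun n => isOpen_thickening,
    htE.trans (iUnion_mono fun n => self_subset_thickening (hδ n) _), ?_⟩
  calc gaugeContent m r (⋃ n, thickening (δ n) (t n))
      ≤ ∑' n, gaugeContent m r (thickening (δ n) (t n)) := measure_iUnion_le _
    _ ≤ ∑' n, ((⨆ _ : (t n).Nonempty, m (ediam (t n))) + a n) := ENNReal.tsum_le_tsum hδ_cost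
    _ = (∑' n, ⨆ _ : (t n).Nonempty, m (ediam (t n))) + ∑' n, a n := ENNReal.tsum_add
    _ ≤ q + (r - q) := add_le_add hcost.le hsum.le
    _ = r := add_tsub_cancel_of_le hqr.le

theorem mkMetric_eq_zero_iff_exists_isOpen (hmono : MonotoneOn m (Iio ⊤))
    (hcont : ∀ t < ⊤, ContinuousWithinAt m (Ici t) t) {E : Set X} :
    Measure.mkMetric m E = 0 ↔
      ∀ n : ℕ, ∃ U, IsOpen U ∧ E ⊆ U ∧ gaugeContent m (n : ℝ≥0∞)⁻¹ U ≤ (n : ℝ≥0∞)⁻¹ := by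
  refine ⟨fun hE n => exists_isOpen_gaugeContent_le hmono hcont hE (by simp), fun h => ?_⟩
  refine tendsto_nhds_unique (tendsto_gaugeContent m E)
    (tendsto_of_tendsto_of_tendsto_of_le_of_le tendsto_const_nhds
      ENNReal.tendsto_inv_nat_nhds_zero (fun _ => zero_le) fun n => ?_)
  obtain ⟨U, -, hEU, hU⟩ := h n
  exact (measure_mono hEU).trans hU

end Gauge

namespace CBar

theorem continuous_toDisc : Continuous toDisc :=
  continuous_induced_dom

theorem fin_injective : Function.Injective fin :=
  fun _ _ => fin.inj

theorem continuous_fin : Continuous fin := by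
  refine continuous_induced_rng.2 ?_
  change Continuous fun z : ℂ => z / ((1 + ‖z‖ : ℝ) : ℂ)
  refine continuous_id.div (by fun_prop) fun z => ?_
  exact_mod_cast (by positivity : (0 : ℝ) < 1 + ‖z‖).ne'

/-- The left inverse of `fin` with junk value `0` at the infinite points. It is given by the
inverse `w ↦ w / (1 - |w|)` of `toDisc`, which makes its continuity at finite points evident. -/
noncomputable def toComplex (x : CBar) : ℂ := toDisc x / ((1 - ‖toDisc x‖ : ℝ) : ℂ)

@[simp]
theorem toComplex_fin (z : ℂ) : toComplex (fin z) = z := by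
  have h : (1 + ‖z‖ : ℝ) ≠ 0 := by positivity
  have h' : ((1 + ‖z‖ : ℝ) : ℂ) ≠ 0 := by exact_mod_cast h
  have hdenom : 1 - ‖toDisc (fin z)‖ = (1 + ‖z‖)⁻¹ := by
    rw [norm_toDisc_fin]
    field_simp
    ring
  rw [toComplex, hdenom, toDisc, Complex.ofReal_inv, div_inv_eq_mul, div_mul_cancel₀ _ h']

theorem norm_toDisc_lt_one_iff {x : CBar} : ‖toDisc x‖ < 1 ↔ x ∈ range fin := by
  cases x with
  | fin z => simpa using norm_toDisc_fin_lt_one z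
  | inf u => simpa [toDisc] using (Circle.norm_coe u).ge

theorem isOpen_range_fin : IsOpen (range fin) := by
  have hrange : range fin = {x | ‖toDisc x‖ < 1} := Set.ext fun _ => norm_toDisc_lt_one_iff.symm
  rw [hrange]
  exact isOpen_lt continuous_toDisc.norm continuous_const

theorem continuousAt_toComplex {x : CBar} (hx : x ∈ range fin) : ContinuousAt toComplex x := by
  refine continuous_toDisc.continuousAt.div
    (Complex.continuous_ofReal.comp (continuous_const.sub continuous_toDisc.norm)).continuousAt ?_
  exact_mod_cast (sub_pos.2 (norm_toDisc_lt_one_iff.2 hx)).ne'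

theorem dist_fin_inf_le {R : ℝ} (hR : 0 < R) (u : Circle) :
    dist (fin (R * u)) (inf u) ≤ R⁻¹ := by
  have hnorm : ‖(R * u : ℂ)‖ = R := by
    rw [norm_mul, Circle.norm_coe, mul_one, Complex.norm_real, Real.norm_of_nonneg hR.le]
  have hne : (1 + R : ℂ) ≠ 0 := by exact_mod_cast (by positivity : 1 + R ≠ 0)
  have hdiff : toDisc (fin (R * u)) - toDisc (inf u) = -((1 + R : ℝ) : ℂ)⁻¹ * u := by
    simp only [toDisc, hnorm]
    push_cast
    field_simp
    ring
  rw [dist_def, hdiff, norm_mul, norm_neg, norm_inv, Complex.norm_real, Circle.norm_coe, mul_one,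
    Real.norm_of_nonneg (by positivity)]
  gcongr
  linarith

theorem dist_fin_mul_exp_inf_le {c : ℝ} (hc : 0 < c) (w : ℂ) :
    dist (fin (c * Complex.exp (Complex.I * w))) (inf (Circle.exp w.re)) ≤ Real.exp w.im / c := by
  have hpolar : c * Complex.exp (Complex.I * w) =
      (c * Real.exp (-w.im) : ℝ) * (Circle.exp w.re : ℂ) := by
    rw [Circle.coe_exp, Complex.ofReal_mul, Complex.ofReal_exp, mul_assoc, ← Complex.exp_add]
    congr 2
    apply Complex.ext <;> simp
  rw [hpolar]
  refine (dist_fin_inf_le (by positivity) _).trans_eq ?_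
  rw [mul_inv, ← Real.exp_neg, neg_neg, inv_mul_eq_div]

end CBar

section ClosedDisc

theorem norm_coe_le_one (z : ClosedDisc) : ‖(z : ℂ)‖ ≤ 1 :=
  mem_closedBall_zero_iff.1 z.2

theorem mem_openDisc_iff {z : ClosedDisc} : z ∈ openDisc ↔ (z : ℂ) ∈ ball 0 1 :=
  mem_ball_zero_iff.symm

theorem coe_image_openDisc : ((↑) : ClosedDisc → ℂ) '' openDisc = ball 0 1 := by
  ext z
  simpa [openDisc] using le_of_lt

theorem zero_mem_openDisc : (0 : ClosedDisc) ∈ openDisc := by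
  simp [openDisc]

theorem mul_mem_openDisc {r : ClosedDisc} (hr : r ∈ openDisc) (z : ClosedDisc) :
    r * z ∈ openDisc := by
  rw [mem_openDisc_iff, mem_ball_zero_iff] at *
  simpa using mul_lt_one_of_nonneg_of_lt_one_left (norm_nonneg _) hr (norm_coe_le_one z)

theorem dense_openDisc : Dense openDisc := by
  rw [Subtype.dense_iff, coe_image_openDisc, closure_ball 0 one_ne_zero]

theorem eventually_forall_dist_mul_lt {M Y : Type*} [TopologicalSpace M] [CompactSpace M]
    [MulOneClass M] [ContinuousMul M] [PseudoMetricSpace Y] (f : C(M, Y)) {ε : ℝ} (hε : 0 < ε) :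
    ∀ᶠ r in 𝓝 (1 : M), ∀ z, dist (f (r * z)) (f z) < ε := by
  have hnear : ∀ᶠ r in 𝓝 (1 : M), ∀ z ∈ univ, dist (f (r * z)) (f z) < ε := by
    refine isCompact_univ.eventually_forall_of_forall_eventually fun z _ => ?_
    have hcont : Continuous fun p : M × M => dist (f (p.1 * p.2)) (f p.2) := by fun_prop
    exact hcont.continuousAt.eventually_lt_const (by simpa using hε)
  simpa only [mem_univ, true_implies] using hnear

theorem exists_mem_openDisc_dist_mul_lt {Y : Type*} [PseudoMetricSpace Y] (f : C(ClosedDisc, Y))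
    {ε : ℝ} (hε : 0 < ε) : ∃ r ∈ openDisc, ∀ z, dist (f (r * z)) (f z) < ε :=
  dense_openDisc.inter_nhds_nonempty (eventually_forall_dist_mul_lt f hε)

/-- The extension by zero to the plane of a function on the closed disc. -/
noncomputable def discExtend {E : Type*} [Zero E] (f : ClosedDisc → E) : ℂ → E :=
  Function.extend (↑) f 0

@[simp]
theorem discExtend_coe {E : Type*} [Zero E] (f : ClosedDisc → E) (z : ClosedDisc) :
    discExtend f z = f z :=
  Subtype.val_injective.extend_apply f 0 z

theorem continuousOn_discExtend {E : Type*} [Zero E] [TopologicalSpace E] {f : ClosedDisc → E}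
    (hf : Continuous f) : ContinuousOn (discExtend f) (closedBall 0 1) := by
  rw [continuousOn_iff_continuous_domRestrict]
  exact hf.congr fun z => (discExtend_coe f z).symm

theorem differentiableOn_discExtend_iff {f : ClosedDisc → ℂ} :
    DifferentiableOn ℂ (discExtend f) (ball 0 1) ↔
      ∃ g : ℂ → ℂ, DifferentiableOn ℂ g (ball 0 1) ∧ ∀ z ∈ openDisc, f z = g z := by
  refine ⟨fun h => ⟨_, h, fun z _ => (discExtend_coe f z).symm⟩, fun ⟨g, hg, hfg⟩ => ?_⟩
  refine hg.congr fun z hz => ?_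
  lift z to ClosedDisc using ball_subset_closedBall hz
  rw [discExtend_coe, hfg z (mem_openDisc_iff.2 hz)]

end ClosedDisc

section FiniteType

/-- The function with values in `ℂ` underlying a function of finite type, extended by zero off the
closed disc. At boundary points with an infinite value it takes the junk value `0`. -/
noncomputable def finitePart (f : C(ClosedDisc, CBar)) : ℂ → ℂ :=
  discExtend fun z => (f z).toComplex

theorem finitePart_coe (f : C(ClosedDisc, CBar)) (z : ClosedDisc) :
    finitePart f z = (f z).toComplex :=
  discExtend_coe _ z

theorem IsFiniteType.differentiableOn_finitePart {f : C(ClosedDisc, CBar)} (hf : IsFiniteType f) :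
    DifferentiableOn ℂ (finitePart f) (ball 0 1) := by
  obtain ⟨g, hg, hfg⟩ := hf
  exact differentiableOn_discExtend_iff.2 ⟨g, hg, fun z hz => by rw [hfg z hz, CBar.toComplex_fin]⟩

theorem IsFiniteType.mem_range_fin {f : C(ClosedDisc, CBar)} (hf : IsFiniteType f)
    {z : ClosedDisc} (hz : z ∈ openDisc) : f z ∈ range CBar.fin := by
  obtain ⟨g, -, hfg⟩ := hf
  exact ⟨g z, (hfg z hz).symm⟩

theorem isFiniteType_iff (f : ABar) : IsFiniteType f.1 ↔ f.1 0 ∈ range CBar.fin := by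
  refine ⟨fun hf => hf.mem_range_fin zero_mem_openDisc, fun hf => f.2.resolve_right ?_⟩
  rintro ⟨θ, -, -, hθ⟩
  simp [hθ] at hf

theorem isOpen_isFiniteType : IsOpen {f : ABar | IsFiniteType f.1} := by
  simp only [isFiniteType_iff]
  exact CBar.isOpen_range_fin.preimage ((continuous_eval_const 0).comp continuous_subtype_val)

end FiniteType

section DiscAlgebra

/-- The disc algebra: the continuous functions on the closed disc that are holomorphic inside. -/
def discAlgebra : Set C(ClosedDisc, ℂ) := {f | DifferentiableOn ℂ (discExtend f) (ball 0 1)}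

theorem tendstoUniformlyOn_discExtend (f : C(ClosedDisc, ℂ)) :
    TendstoUniformlyOn (fun h : C(ClosedDisc, ℂ) => discExtend h) (discExtend f) (𝓝 f)
      (closedBall 0 1) := by
  rw [Metric.tendstoUniformlyOn_iff]
  intro ε hε
  filter_upwards [ball_mem_nhds f hε] with h hh z hz
  lift z to ClosedDisc using hz
  simp only [discExtend_coe]
  exact (ContinuousMap.dist_apply_le_dist z).trans_lt (mem_ball'.1 hh)

theorem isClosed_discAlgebra : IsClosed discAlgebra := by
  refine isClosed_of_closure_subset fun f hf => ?_
  have : (𝓝[discAlgebra] f).NeBot := mem_closure_iff_nhdsWithin_neBot.1 hf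
  have hlim : TendstoUniformlyOn (fun h : C(ClosedDisc, ℂ) => discExtend h) (discExtend f)
      (𝓝[discAlgebra] f) (ball 0 1) := fun u hu =>
    ((tendstoUniformlyOn_discExtend f).mono ball_subset_closedBall u hu).filter_mono
      nhdsWithin_le_nhds
  exact hlim.tendstoLocallyUniformlyOn.differentiableOn self_mem_nhdsWithin isOpen_ball

instance : CompleteSpace discAlgebra :=
  isClosed_discAlgebra.completeSpace_coe

namespace discAlgebra

theorem diffContOnCl_discExtend (p : discAlgebra) : DiffContOnCl ℂ (discExtend p.1) (ball 0 1) :=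
  ⟨p.2, by simpa [closure_ball] using continuousOn_discExtend p.1.continuous⟩

/-- The restriction to the closed disc of a function that is holomorphic on the open disc and
continuous up to the boundary. -/
noncomputable def ofDiffContOnCl (Q : ℂ → ℂ) (hQ : DiffContOnCl ℂ Q (ball 0 1)) : discAlgebra :=
  ⟨⟨fun z => Q z, hQ.continuousOn_ball.comp_continuous continuous_subtype_val fun z => z.2⟩,
    differentiableOn_discExtend_iff.2 ⟨Q, hQ.differentiableOn, fun _ _ => rfl⟩⟩

@[simp]
theorem ofDiffContOnCl_apply {Q : ℂ → ℂ} (hQ : DiffContOnCl ℂ Q (ball 0 1)) (z : ClosedDisc) :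
    (ofDiffContOnCl Q hQ).1 z = Q z :=
  rfl

/-- The inclusion of the disc algebra in the extended disc algebra. -/
noncomputable def toABar (p : discAlgebra) : ABar :=
  ⟨⟨fun z => CBar.fin (p.1 z), CBar.continuous_fin.comp p.1.continuous⟩, Or.inl
    ⟨discExtend p.1, p.2, fun z _ => congrArg CBar.fin (discExtend_coe p.1 z).symm⟩⟩

@[simp]
theorem toABar_apply (p : discAlgebra) (z : ClosedDisc) : (toABar p).1 z = CBar.fin (p.1 z) :=
  rfl

theorem isFiniteType_toABar (p : discAlgebra) : IsFiniteType (toABar p).1 :=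
  (isFiniteType_iff _).2 ⟨p.1 0, rfl⟩

theorem continuous_toABar : Continuous toABar :=
  Continuous.subtype_mk ((ContinuousMap.continuous_postcomp
    (⟨CBar.fin, CBar.continuous_fin⟩ : C(ℂ, CBar))).comp continuous_subtype_val) _

end discAlgebra

theorem diffContOnCl_comp_mul {g : ℂ → ℂ} (hg : DifferentiableOn ℂ g (ball 0 1))
    {r : ClosedDisc} (hr : r ∈ openDisc) : DiffContOnCl ℂ (fun z => g (r * z)) (ball 0 1) := by
  refine DifferentiableOn.diffContOnCl ?_
  rw [closure_ball 0 one_ne_zero]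
  refine hg.comp (by fun_prop) fun z hz => ?_
  lift z to ClosedDisc using hz
  exact mem_openDisc_iff.1 (mul_mem_openDisc hr z)

theorem IsFiniteType.exists_dist_toABar_lt {f : C(ClosedDisc, CBar)} (hf : IsFiniteType f)
    {ε : ℝ} (hε : 0 < ε) : ∃ p, dist f (discAlgebra.toABar p).1 < ε := by
  obtain ⟨g, hg, hfg⟩ := hf
  obtain ⟨r, hr, hrf⟩ := exists_mem_openDisc_dist_mul_lt f hε
  refine ⟨discAlgebra.ofDiffContOnCl _ (diffContOnCl_comp_mul hg hr),
    (ContinuousMap.dist_lt_iff hε).2 fun z => ?_⟩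
  rw [dist_comm]
  simpa [hfg _ (mul_mem_openDisc hr z)] using hrf z

/-- For `θ = Re h` the functions `n e^{i h} = n e^{-Im h} e^{i θ}` converge to `∞ e^{i θ}` as
`n → ∞`. -/
theorem IsInfiniteType.exists_dist_toABar_lt {f : C(ClosedDisc, CBar)} (hf : IsInfiniteType f)
    {ε : ℝ} (hε : 0 < ε) : ∃ p, dist f (discAlgebra.toABar p).1 < ε := by
  obtain ⟨θ, -, hθ, hfθ⟩ := hf
  obtain ⟨H, hH, hHθ⟩ := hθ.exists_analyticOnNhd_ball_re_eq
  obtain ⟨r, hr, hrf⟩ := exists_mem_openDisc_dist_mul_lt f (half_pos hε)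
  have hh := diffContOnCl_comp_mul hH.differentiableOn hr
  set h : ℂ → ℂ := fun z => H (r * z)
  have hf_scaled (z : ClosedDisc) : f (r * z) = CBar.inf (Circle.exp (h z).re) := by
    rw [hfθ]
    exact congrArg (CBar.inf ∘ Circle.exp) (hHθ (mem_openDisc_iff.1 (mul_mem_openDisc hr z))).symm
  obtain ⟨B, hB⟩ := (isCompact_closedBall (0 : ℂ) 1).exists_bound_of_continuousOn
    hh.continuousOn_ball
  obtain ⟨n, hn⟩ := exists_nat_gt (Real.exp B / (ε / 2))
  have hn_pos : (0 : ℝ) < n := lt_trans (by positivity) hn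
  have hp : DiffContOnCl ℂ (fun z => n * Complex.exp (Complex.I * h z)) (ball 0 1) := by
    have hexp : Differentiable ℂ fun w => n * Complex.exp (Complex.I * w) := by fun_prop
    exact hexp.comp_diffContOnCl hh
  refine ⟨discAlgebra.ofDiffContOnCl _ hp, (ContinuousMap.dist_lt_iff hε).2 fun z => ?_⟩
  have him : (h z).im ≤ B := (Complex.im_le_norm _).trans (hB z z.2)
  calc dist (f z) (CBar.fin (n * Complex.exp (Complex.I * h z)))
      ≤ dist (f (r * z)) (f z) + dist (f (r * z)) (CBar.fin (n * Complex.exp (Complex.I * h z))) :=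
        dist_triangle_left _ _ _
    _ < ε / 2 + ε / 2 := by
        refine add_lt_add_of_lt_of_le (hrf z) ?_
        rw [hf_scaled, dist_comm]
        refine (CBar.dist_fin_mul_exp_inf_le hn_pos (h z)).trans ((div_le_iff₀ hn_pos).2 ?_)
        exact (Real.exp_le_exp.2 him).trans ((div_lt_iff₀' (half_pos hε)).1 hn).le
    _ = ε := add_halves ε

theorem denseRange_toABar : DenseRange discAlgebra.toABar :=
  Metric.denseRange_iff.2 fun f _ hε =>
    f.2.elim (·.exists_dist_toABar_lt hε) (·.exists_dist_toABar_lt hε)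

end DiscAlgebra

section Hurwitz

theorem ball_subset_image_closedBall_of_le_sphere {f : ℂ → ℂ} {z₀ : ℂ} {r m : ℝ}
    (h : DiffContOnCl ℂ f (ball z₀ r)) (hr : 0 < r) (hm : 0 < m)
    (hf : ∀ z ∈ sphere z₀ r, m ≤ ‖f z - f z₀‖) :
    ball (f z₀) (m / 2) ⊆ f '' closedBall z₀ r := by
  refine h.ball_subset_image_closedBall hr hf fun hconst => ?_
  simp only [not_not] at hconst
  have hball : EqOn f (fun _ => f z₀) (ball z₀ r) :=
    (h.differentiableOn.analyticOnNhd isOpen_ball).eqOn_of_preconnected_of_eventuallyEq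
      analyticOnNhd_const (convex_ball z₀ r).isPreconnected (mem_ball_self hr) hconst
  have hclosure : EqOn f (fun _ => f z₀) (closedBall z₀ r) :=
    hball.of_subset_closure h.continuousOn_ball continuousOn_const ball_subset_closedBall
      (closure_ball z₀ hr.ne').ge
  obtain ⟨z, hz⟩ := (NormedSpace.sphere_nonempty (x := z₀) (r := r)).2 hr.le
  refine hm.not_ge ((hf z hz).trans_eq ?_)
  rw [hclosure (sphere_subset_closedBall hz), sub_self, norm_zero]

/-- A substitute for Rouché's theorem. -/
theorem ball_subset_image_closedBall_of_norm_sub_le {f g : ℂ → ℂ} {z₀ : ℂ} {r m ε : ℝ}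
    (h : DiffContOnCl ℂ f (ball z₀ r)) (hr : 0 < r)
    (hg : ∀ z ∈ sphere z₀ r, m ≤ ‖g z - g z₀‖) (hfg : ∀ z ∈ closedBall z₀ r, ‖f z - g z‖ ≤ ε) :
    ball (g z₀) (m / 2 - 2 * ε) ⊆ f '' closedBall z₀ r := by
  intro w hw
  have hz₀ := hfg z₀ (mem_closedBall_self hr.le)
  have hpos : 0 < m / 2 - 2 * ε := dist_nonneg.trans_lt hw
  have hε : 0 ≤ ε := (norm_nonneg _).trans hz₀
  refine ball_subset_image_closedBall_of_le_sphere (m := m - 2 * ε) h hr (by linarith) ?_ ?_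
  · intro z hz
    have htri : ‖g z - g z₀‖ ≤ ‖f z - f z₀‖ + ‖f z - g z‖ + ‖f z₀ - g z₀‖ := by
      calc ‖g z - g z₀‖ = ‖(f z - f z₀) - (f z - g z) + (f z₀ - g z₀)‖ := by congr 1; ring
        _ ≤ _ := (norm_add_le _ _).trans (by gcongr; exact norm_sub_le _ _)
    linarith [hg z hz, hfg z (sphere_subset_closedBall hz)]
  · rw [mem_ball] at hw ⊢
    have htri := dist_triangle w (g z₀) (f z₀)
    rw [dist_comm (g z₀), dist_eq_norm (f z₀)] at htri
    linarith

theorem exists_closedBall_subset_sphere_ne {g : ℂ → ℂ} {U : Set ℂ} (hU : IsOpen U)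
    (hU_conn : IsPreconnected U) (hg : DifferentiableOn ℂ g U) {x z₀ : ℂ} (hx : x ∈ U)
    (hz₀ : z₀ ∈ U) (hne : g x ≠ g z₀) :
    ∃ r > 0, closedBall z₀ r ⊆ U ∧ ∀ z ∈ sphere z₀ r, g z ≠ g z₀ := by
  have han := hg.analyticOnNhd hU
  have hisolated : ∀ᶠ z in 𝓝[≠] z₀, g z ≠ g z₀ :=
    ((han z₀ hz₀).eventually_eq_or_eventually_ne analyticAt_const).resolve_left fun hconst =>
      hne (han.eqOn_of_preconnected_of_eventuallyEq analyticOnNhd_const hU_conn hz₀ hconst hx)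
  rw [eventually_nhdsWithin_iff] at hisolated
  obtain ⟨s, hs, hball⟩ := nhds_basis_closedBall.eventually_iff.1
    (hisolated.and (hU.eventually_mem hz₀))
  exact ⟨s, hs, fun z hz => (hball hz).2, fun z hz =>
    (hball (sphere_subset_closedBall hz)).1 (ne_of_mem_sphere hz hs.ne')⟩

/-- Hurwitz's theorem. -/
theorem eventually_mem_image_of_tendstoLocallyUniformlyOn {ι : Type*} {l : Filter ι} {U : Set ℂ}
    {F : ι → ℂ → ℂ} {g : ℂ → ℂ} (hU : IsOpen U) (hU_conn : IsPreconnected U)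
    (hFg : TendstoLocallyUniformlyOn F g l U) (hF : ∀ᶠ i in l, DifferentiableOn ℂ (F i) U)
    {x z₀ : ℂ} (hx : x ∈ U) (hz₀ : z₀ ∈ U) (hne : g x ≠ g z₀) {w : ι → ℂ}
    (hw : Tendsto w l (𝓝 (g z₀))) : ∀ᶠ i in l, w i ∈ F i '' U := by
  rcases l.eq_or_neBot with rfl | _
  · exact eventually_bot
  have hg : DifferentiableOn ℂ g U := hFg.differentiableOn hF hU
  obtain ⟨r, hr, hrU, hsphere⟩ := exists_closedBall_subset_sphere_ne hU hU_conn hg hx hz₀ hne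
  obtain ⟨y, hy, hmin⟩ := (isCompact_sphere z₀ r).exists_isMinOn
    (NormedSpace.sphere_nonempty.2 hr.le) (f := fun z => ‖g z - g z₀‖)
    ((hg.continuousOn.mono (sphere_subset_closedBall.trans hrU)).sub continuousOn_const).norm
  set m := ‖g y - g z₀‖
  have hm : 0 < m := norm_pos_iff.2 (sub_ne_zero.2 (hsphere y hy))
  have hunif : ∀ᶠ i in l, ∀ z ∈ closedBall z₀ r, ‖F i z - g z‖ ≤ m / 8 := by
    have := (tendstoLocallyUniformlyOn_iff_forall_isCompact hU).1 hFg _ hrU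
      (isCompact_closedBall z₀ r)
    filter_upwards [Metric.tendstoUniformlyOn_iff.1 this (m / 8) (by positivity)] with i hi z hz
    rw [norm_sub_rev, ← dist_eq_norm]
    exact (hi z hz).le
  filter_upwards [hF, hunif, hw.eventually_mem (ball_mem_nhds _ (by positivity : 0 < m / 4))]
    with i hFi hclose hwi
  refine image_mono hrU (ball_subset_image_closedBall_of_norm_sub_le
    ((hFi.mono hrU).diffContOnCl_ball subset_rfl) hr (isMinOn_iff.1 hmin) hclose ?_)
  convert hwi using 2
  ring

end Hurwitz

section Bump

/-- A holomorphic function on the right half-plane that is bounded, vanishes at `1` and tends to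
zero at infinity. -/
noncomputable def bump (w : ℂ) : ℂ := (1 - w) / (1 + w) ^ 2

@[simp]
theorem bump_one : bump 1 = 0 := by simp [bump]

theorem one_add_norm_le {w : ℂ} (hw : 0 ≤ w.re) : 1 + ‖w‖ ≤ 2 * ‖1 + w‖ := by
  have hone : 1 ≤ ‖1 + w‖ :=
    calc (1 : ℝ) ≤ (1 + w).re := by simpa using hw
      _ ≤ ‖1 + w‖ := Complex.re_le_norm _
  have hnorm : ‖w‖ ≤ ‖1 + w‖ := by
    rw [← sq_le_sq₀ (norm_nonneg _) (norm_nonneg _), Complex.sq_norm, Complex.sq_norm,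
      Complex.normSq_add]
    simp only [map_one, one_mul, Complex.conj_re]
    linarith
  linarith

theorem one_add_ne_zero {w : ℂ} (hw : 0 ≤ w.re) : 1 + w ≠ 0 :=
  norm_pos_iff.1 (by linarith [one_add_norm_le hw, norm_nonneg w])

theorem norm_bump_le {w : ℂ} (hw : 0 ≤ w.re) : ‖bump w‖ ≤ 2 / (1 + ‖w‖) := by
  have hpos : 0 < ‖1 + w‖ := norm_pos_iff.2 (one_add_ne_zero hw)
  have hsymm : ‖1 - w‖ ≤ ‖1 + w‖ := by
    rw [← sq_le_sq₀ (norm_nonneg _) (norm_nonneg _), Complex.sq_norm, Complex.sq_norm,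
      Complex.normSq_add, Complex.normSq_sub]
    simp only [map_one, one_mul, Complex.conj_re]
    linarith
  calc ‖bump w‖ = ‖1 - w‖ / ‖1 + w‖ ^ 2 := by rw [bump, norm_div, norm_pow]
    _ ≤ ‖1 + w‖ / ‖1 + w‖ ^ 2 := by gcongr
    _ = 2 / (2 * ‖1 + w‖) := by field_simp
    _ ≤ 2 / (1 + ‖w‖) := by gcongr; exact one_add_norm_le hw

theorem le_norm_bump {w : ℂ} (hw : w ∈ sphere 1 (1 / 2)) : 2 / 25 ≤ ‖bump w‖ := by
  have hnum : ‖1 - w‖ = 1 / 2 := by rw [norm_sub_rev, ← dist_eq_norm, hw]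
  have hden : ‖1 + w‖ ≤ 5 / 2 :=
    calc ‖1 + w‖ = ‖2 - (1 - w)‖ := by congr 1; ring
      _ ≤ 2 + 1 / 2 := (norm_sub_le _ _).trans_eq (by rw [hnum, Complex.norm_ofNat])
      _ = 5 / 2 := by norm_num
  have hden_pos : 0 < ‖1 + w‖ := by
    have := norm_sub_norm_le (2 : ℂ) (1 - w)
    rw [show (2 : ℂ) - (1 - w) = 1 + w by ring, hnum, Complex.norm_ofNat] at this
    linarith
  rw [bump, norm_div, norm_pow, hnum, le_div_iff₀ (by positivity)]
  nlinarith

/-- The bump of width `1 / M` at the point `j` of the unit circle. -/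
noncomputable def bumpAt (M : ℝ) (j z : ℂ) : ℂ := bump (M * (1 - z * starRingEnd ℂ j))

/-- The point `z` of the plane with `M (1 - z / j) = w`. -/
noncomputable def peakPoint (M : ℝ) (j w : ℂ) : ℂ := j * (1 - w / M)

variable {M : ℝ} {j z w : ℂ}

theorem re_one_sub_mul_conj_nonneg (hj : j ∈ sphere 0 1) (hz : z ∈ closedBall 0 1) :
    0 ≤ (1 - z * starRingEnd ℂ j).re := by
  have h : (z * starRingEnd ℂ j).re ≤ 1 := by
    refine (Complex.re_le_norm _).trans ?_
    simpa [mem_sphere_zero_iff_norm.1 hj] using hz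
  simpa using h

theorem norm_one_sub_mul_conj (hj : j ∈ sphere 0 1) : ‖1 - z * starRingEnd ℂ j‖ = ‖z - j‖ := by
  have hj' : ‖j‖ = 1 := mem_sphere_zero_iff_norm.1 hj
  have : 1 - z * starRingEnd ℂ j = (j - z) * starRingEnd ℂ j := by
    rw [sub_mul, Complex.mul_conj', hj', Complex.ofReal_one, one_pow]
  rw [this, norm_mul, RCLike.norm_conj, hj', mul_one, norm_sub_rev]

theorem re_bumpAt_arg_nonneg (hM : 0 ≤ M) (hj : j ∈ sphere 0 1) (hz : z ∈ closedBall 0 1) :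
    0 ≤ (M * (1 - z * starRingEnd ℂ j)).re := by
  rw [Complex.re_ofReal_mul]
  exact mul_nonneg hM (re_one_sub_mul_conj_nonneg hj hz)

theorem norm_bumpAt_le (hM : 0 ≤ M) (hj : j ∈ sphere 0 1) (hz : z ∈ closedBall 0 1) :
    ‖bumpAt M j z‖ ≤ 2 / (1 + M * ‖z - j‖) := by
  refine (norm_bump_le (re_bumpAt_arg_nonneg hM hj hz)).trans_eq ?_
  rw [norm_mul, norm_one_sub_mul_conj hj, Complex.norm_real, Real.norm_of_nonneg hM]

theorem differentiableOn_bumpAt (hM : 0 ≤ M) (hj : j ∈ sphere 0 1) :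
    DifferentiableOn ℂ (bumpAt M j) (closedBall 0 1) := by
  unfold bumpAt bump
  refine DifferentiableOn.div (by fun_prop) (by fun_prop) fun z hz => ?_
  exact pow_ne_zero 2 (one_add_ne_zero (re_bumpAt_arg_nonneg hM hj hz))

theorem bumpAt_peakPoint (hM : M ≠ 0) (hj : j ∈ sphere 0 1) :
    bumpAt M j (peakPoint M j w) = bump w := by
  have hM' : (M : ℂ) ≠ 0 := by exact_mod_cast hM
  have hjj : j * starRingEnd ℂ j = 1 := by
    simp [Complex.mul_conj', mem_sphere_zero_iff_norm.1 hj]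
  rw [bumpAt, peakPoint, mul_right_comm, hjj]
  congr 1
  field_simp
  ring

theorem dist_peakPoint (hM : 0 < M) (hj : j ∈ sphere 0 1) :
    dist (peakPoint M j w) j = ‖w‖ / M := by
  have : peakPoint M j w - j = -(j * (w / M)) := by rw [peakPoint]; ring
  rw [dist_eq_norm, this, norm_neg, norm_mul, mem_sphere_zero_iff_norm.1 hj, one_mul, norm_div,
    Complex.norm_real, Real.norm_of_nonneg hM.le]

theorem norm_le_of_mem_closedBall_one (hw : w ∈ closedBall 1 (1 / 2)) : ‖w‖ ≤ 2 := by
  have := norm_le_norm_add_norm_sub 1 w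
  rw [norm_one, norm_sub_rev, ← dist_eq_norm] at this
  linarith [mem_closedBall.1 hw]

theorem peakPoint_mem_ball (hM : 1 ≤ M) (hj : j ∈ sphere 0 1) (hw : w ∈ closedBall 1 (1 / 2)) :
    peakPoint M j w ∈ ball 0 1 := by
  have hM_pos : 0 < M := one_pos.trans_le hM
  have hM' : (M : ℂ) ≠ 0 := by exact_mod_cast hM_pos.ne'
  rw [mem_ball_zero_iff, peakPoint, norm_mul, mem_sphere_zero_iff_norm.1 hj, one_mul]
  have hsplit : 1 - w / M = ((1 - 1 / M : ℝ) : ℂ) - (w - 1) / M := by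
    push_cast
    field_simp
    ring
  calc ‖1 - w / M‖ ≤ (1 - 1 / M) + ‖w - 1‖ / M := by
        rw [hsplit]
        refine (norm_sub_le _ _).trans_eq ?_
        rw [norm_div, Complex.norm_real, Complex.norm_real, Real.norm_of_nonneg hM_pos.le,
          Real.norm_of_nonneg (sub_nonneg.2 ((div_le_one hM_pos).2 hM))]
    _ ≤ (1 - 1 / M) + 1 / 2 / M := by gcongr; exact mem_closedBall_iff_norm.1 hw
    _ < 1 := by
        have : 0 < 1 / M := by positivity
        rw [div_right_comm]
        linarith

end Bump

section BumpSum

theorem exists_pos_pairwise_le_dist {X : Type*} [MetricSpace X] (t : Finset X) :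
    ∃ s > 0, (t : Set X).Pairwise fun i j => s ≤ dist i j := by
  rcases (t : Set X).subsingleton_or_nontrivial with ht | ht
  · exact ⟨1, one_pos, ht.pairwise _⟩
  · exact ⟨_, infsep_pos_iff_nontrivial_of_finite.2 ht,
      fun i hi j hj => infsep_le_dist_of_mem hi hj⟩

/-- The sum of the bumps of width `1 / M` at the points of a finite subset of the unit circle. -/
noncomputable def bumpSum (t : Finset ℂ) (M : ℝ) (z : ℂ) : ℂ := ∑ j ∈ t, bumpAt M j z

variable {t : Finset ℂ} {M σ : ℝ} {j z : ℂ}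

theorem diffContOnCl_bumpSum (ht : (t : Set ℂ) ⊆ sphere 0 1) (hM : 0 ≤ M) :
    DiffContOnCl ℂ (bumpSum t M) (ball 0 1) := by
  refine DifferentiableOn.diffContOnCl ?_
  rw [closure_ball 0 one_ne_zero]
  exact DifferentiableOn.fun_sum fun j hj => differentiableOn_bumpAt hM (ht hj)

theorem norm_bumpSum_le_of_far (ht : (t : Set ℂ) ⊆ sphere 0 1) (hM : 0 < M) (hσ : 0 < σ)
    (hz : z ∈ closedBall 0 1) (hfar : ∀ j ∈ t, σ ≤ dist z j) :
    ‖bumpSum t M z‖ ≤ t.card * (2 / (M * σ)) := by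
  rw [← nsmul_eq_mul, ← Finset.sum_const]
  refine norm_sum_le_of_le _ fun j hj => (norm_bumpAt_le hM.le (ht hj) hz).trans ?_
  have hle : M * σ ≤ M * ‖z - j‖ := by
    rw [← dist_eq_norm]
    exact mul_le_mul_of_nonneg_left (hfar j hj) hM.le
  gcongr
  linarith

theorem norm_bumpSum_sub_bumpAt_le (ht : (t : Set ℂ) ⊆ sphere 0 1)
    (hsep : (t : Set ℂ).Pairwise fun i j => 2 * σ ≤ dist i j) (hM : 0 < M) (hσ : 0 < σ)
    (hz : z ∈ closedBall 0 1) (hj : j ∈ t) (hzj : dist z j ≤ σ) :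
    ‖bumpSum t M z - bumpAt M j z‖ ≤ t.card * (2 / (M * σ)) := by
  have hrest : bumpSum t M z - bumpAt M j z = bumpSum (t.erase j) M z := by
    rw [bumpSum, ← Finset.add_sum_erase t _ hj, add_sub_cancel_left, bumpSum]
  have hfar : ∀ i ∈ t.erase j, σ ≤ dist z i := fun i hi => by
    have := hsep hj (Finset.mem_of_mem_erase hi) (Finset.ne_of_mem_erase hi).symm
    linarith [dist_triangle_left j i z]
  rw [hrest]
  refine (norm_bumpSum_le_of_far (fun i hi => ht (Finset.mem_of_mem_erase hi)) hM hσ hz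
    hfar).trans ?_
  gcongr
  exact Finset.erase_subset j t

theorem norm_bumpSum_le (ht : (t : Set ℂ) ⊆ sphere 0 1)
    (hsep : (t : Set ℂ).Pairwise fun i j => 2 * σ ≤ dist i j) (hM : 0 < M) (hσ : 0 < σ)
    (hz : z ∈ closedBall 0 1) : ‖bumpSum t M z‖ ≤ 2 + t.card * (2 / (M * σ)) := by
  by_cases! hfar : ∀ j ∈ t, σ ≤ dist z j
  · linarith [norm_bumpSum_le_of_far ht hM hσ hz hfar]
  · obtain ⟨j, hj, hzj⟩ := hfar
    have hbump : ‖bumpAt M j z‖ ≤ 2 := by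
      refine (norm_bumpAt_le hM.le (ht hj) hz).trans (div_le_self zero_le_two ?_)
      linarith [mul_nonneg hM.le (norm_nonneg (z - j))]
    have hrest := norm_bumpSum_sub_bumpAt_le ht hsep hM hσ hz hj hzj.le
    linarith [norm_le_norm_add_norm_sub' (bumpSum t M z) (bumpAt M j z)]

theorem exists_bumpSum_approx (ht : (t : Set ℂ) ⊆ sphere 0 1) {δ κ : ℝ} (hδ : 0 < δ)
    (hκ : 0 < κ) :
    ∃ M ≥ 1, (∀ z ∈ closedBall 0 1, ‖bumpSum t M z‖ ≤ 2 + κ) ∧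
      (∀ z ∈ closedBall 0 1, (∀ j ∈ t, δ ≤ dist z j) → ‖bumpSum t M z‖ ≤ κ) ∧
      ∀ j ∈ t, ∀ w ∈ closedBall 1 (1 / 2), dist (peakPoint M j w) j ≤ δ ∧
        ‖bumpSum t M (peakPoint M j w) - bump w‖ ≤ κ := by
  obtain ⟨s, hs, hsep⟩ := exists_pos_pairwise_le_dist t
  set σ := min δ (s / 2)
  have hσ : 0 < σ := by positivity
  have hσδ : σ ≤ δ := min_le_left _ _
  have hsep' : (t : Set ℂ).Pairwise fun i j => 2 * σ ≤ dist i j := fun i hi j hj hij => by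
    linarith [hsep hi hj hij, min_le_right δ (s / 2)]
  obtain ⟨M, hM_one, hMσ, hMκ⟩ : ∃ M : ℝ, 1 ≤ M ∧ 2 / M ≤ σ ∧ t.card * (2 / (M * σ)) ≤ κ := by
    have hpeak : Tendsto (fun M : ℝ => 2 / M) atTop (𝓝 0) :=
      tendsto_const_nhds.div_atTop tendsto_id
    have herror : Tendsto (fun M : ℝ => t.card * (2 / (M * σ))) atTop (𝓝 (t.card * 0)) :=
      (tendsto_const_nhds.div_atTop (tendsto_id.atTop_mul_const hσ)).const_mul _
    rw [mul_zero] at herror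
    exact ((eventually_ge_atTop 1).and
      ((hpeak.eventually_le_const hσ).and (herror.eventually_le_const hκ))).exists
  have hM : 0 < M := one_pos.trans_le hM_one
  refine ⟨M, hM_one, fun z hz => ?_, fun z hz hfar => ?_, fun j hj w hw => ?_⟩
  · linarith [norm_bumpSum_le ht hsep' hM hσ hz]
  · exact (norm_bumpSum_le_of_far ht hM hσ hz fun j hj => hσδ.trans (hfar j hj)).trans hMκ
  · have hdist : dist (peakPoint M j w) j ≤ σ := by
      rw [dist_peakPoint hM (ht hj)]
      exact (by gcongr; exact norm_le_of_mem_closedBall_one hw : ‖w‖ / M ≤ 2 / M).trans hMσ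
    refine ⟨hdist.trans hσδ, ?_⟩
    rw [← bumpAt_peakPoint hM.ne' (ht hj)]
    exact (norm_bumpSum_sub_bumpAt_le ht hsep' hM hσ
      (ball_subset_closedBall (peakPoint_mem_ball hM_one (ht hj) hw)) hj hdist).trans hMκ

end BumpSum

section Perturbation

theorem ball_subset_image_ball_of_peakPoint {Q : ℂ → ℂ} (hQ : DiffContOnCl ℂ Q (ball 0 1))
    {M a ε : ℝ} {j c : ℂ} (hM : 1 ≤ M) (hj : j ∈ sphere 0 1) (ha : 0 ≤ a)
    (hQc : ∀ w ∈ closedBall 1 (1 / 2), ‖Q (peakPoint M j w) - (c + a * bump w)‖ ≤ ε) :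
    ball c (a / 25 - 2 * ε) ⊆ Q '' ball 0 1 := by
  have hmaps : MapsTo (peakPoint M j) (closedBall 1 (1 / 2)) (ball 0 1) := fun w hw =>
    peakPoint_mem_ball hM hj hw
  have hpeak : Differentiable ℂ (peakPoint M j) := by
    unfold peakPoint
    fun_prop
  have hdiff : DiffContOnCl ℂ (Q ∘ peakPoint M j) (ball 1 (1 / 2)) :=
    hQ.comp hpeak.diffContOnCl (hmaps.mono_left ball_subset_closedBall)
  have hsphere : ∀ w ∈ sphere 1 (1 / 2), a * (2 / 25) ≤ ‖(c + a * bump w) - (c + a * bump 1)‖ := by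
    intro w hw
    rw [add_sub_add_left_eq_sub, bump_one, mul_zero, sub_zero, norm_mul, Complex.norm_real,
      Real.norm_of_nonneg ha]
    exact mul_le_mul_of_nonneg_left (le_norm_bump hw) ha
  have hsub := ball_subset_image_closedBall_of_norm_sub_le (g := fun w => c + a * bump w) hdiff
    (by norm_num) hsphere hQc
  rw [bump_one, mul_zero, add_zero, image_comp] at hsub
  refine Subset.trans ?_ (hsub.trans (image_mono hmaps.image_subset))
  exact ball_subset_ball (by linarith)

theorem exists_finset_modulus_net {P : ℂ → ℂ} (hP : ContinuousOn P (closedBall 0 1)) {τ : ℝ}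
    (hτ : 0 < τ) :
    ∃ t : Finset ℂ, (t : Set ℂ) ⊆ sphere 0 1 ∧ ∃ ρ > 0, (∀ ζ ∈ sphere 0 1, ∃ j ∈ t, dist ζ j ≤ ρ) ∧
      ∀ j ∈ t, ∀ z ∈ closedBall 0 1, dist z j ≤ ρ → ‖P z - P j‖ ≤ τ := by
  obtain ⟨ρ, hρ, hP_unif⟩ := Metric.uniformContinuousOn_iff_le.1
    ((isCompact_closedBall (0 : ℂ) 1).uniformContinuousOn_of_continuous hP) τ hτ
  obtain ⟨t, ht, htfin, hcover⟩ := (isCompact_sphere (0 : ℂ) 1).finite_cover_balls hρ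
  lift t to Finset ℂ using htfin
  refine ⟨t, ht, ρ, hρ, fun ζ hζ => ?_, fun j hj z hz hzj => ?_⟩
  · obtain ⟨j, hj, hζj⟩ := mem_iUnion₂.1 (hcover hζ)
    exact ⟨j, hj, (mem_ball.1 hζj).le⟩
  · rw [← dist_eq_norm]
    exact hP_unif z hz j (sphere_subset_closedBall (ht hj)) hzj

theorem exists_perturbation_mem_interior_image {P : ℂ → ℂ} (hP : DiffContOnCl ℂ P (ball 0 1))
    {ε : ℝ} (hε : 0 < ε) :
    ∃ t : Finset ℂ, ∀ U ∈ 𝓝ˢ (t : Set ℂ), ∃ Q : ℂ → ℂ, DiffContOnCl ℂ Q (ball 0 1) ∧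
      (∀ z ∈ closedBall 0 1, ‖Q z - P z‖ ≤ ε) ∧
      ∀ ζ ∈ sphere 0 1, ζ ∉ U → Q ζ ∈ interior (Q '' ball 0 1) := by
  obtain ⟨a, ha, haε⟩ : ∃ a > 0, 3 * a = ε := ⟨ε / 3, by positivity, by ring⟩
  obtain ⟨t, ht, ρ, hρ, hnet, hPρ⟩ :=
    exists_finset_modulus_net hP.continuousOn_ball (by positivity : 0 < a / 200)
  refine ⟨t, fun U hU => ?_⟩
  obtain ⟨δ, hδ, hδU⟩ := (hasBasis_nhdsSet_thickening t.finite_toSet.isCompact).mem_iff.1 hU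
  obtain ⟨M, hM, hbounded, hfar, hnear⟩ := exists_bumpSum_approx ht (lt_min hδ hρ)
    (by norm_num : (0 : ℝ) < 1 / 200)
  set h := bumpSum t M
  have norm_mul_le {w : ℂ} {b : ℝ} (hw : ‖w‖ ≤ b) : ‖a * w‖ ≤ a * b := by
    rw [norm_mul, Complex.norm_real, Real.norm_of_nonneg ha.le]
    gcongr
  have hQ : DiffContOnCl ℂ (fun z => P z + a * h z) (ball 0 1) :=
    hP.add ((diffContOnCl_bumpSum ht (by linarith)).const_smul (a : ℂ))
  refine ⟨_, hQ, fun z hz => ?_, fun ζ hζ hζU => ?_⟩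
  · rw [add_sub_cancel_left]
    linarith [norm_mul_le (hbounded z hz)]
  obtain ⟨j, hj, hζj⟩ := hnet ζ hζ
  have himage : ball (P j) (a / 50) ⊆ (fun z => P z + a * h z) '' ball 0 1 := by
    convert ball_subset_image_ball_of_peakPoint hQ (ε := a / 100) (c := P j) hM (ht hj) ha.le
      fun w hw => ?_ using 2
    · ring
    obtain ⟨hdist, hbump⟩ := hnear j hj w hw
    have hP_near := hPρ j hj _ (ball_subset_closedBall (peakPoint_mem_ball hM (ht hj) hw))
      (hdist.trans (min_le_right _ _))
    have hsplit (p : ℂ) : P p + a * h p - (P j + a * bump w) = P p - P j + a * (h p - bump w) := by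
      ring
    rw [hsplit]
    linarith [norm_add_le_of_le hP_near (norm_mul_le hbump)]
  refine mem_interior.2 ⟨_, himage, isOpen_ball, ?_⟩
  have hζ_far : ∀ i ∈ t, min δ ρ ≤ dist ζ i := fun i hi => by
    by_contra! hlt
    exact hζU (hδU (mem_thickening_iff.2 ⟨i, hi, hlt.trans_le (min_le_left _ _)⟩))
  have hζ := sphere_subset_closedBall hζ
  rw [mem_ball_iff_norm, add_sub_right_comm]
  linarith [norm_add_le_of_le (hPρ j hj ζ hζ hζj) (norm_mul_le (hfar ζ hζ hζ_far))]

end Perturbation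

section AttainedValues

theorem IsFiniteType.fin_finitePart {f : C(ClosedDisc, CBar)} (hf : IsFiniteType f)
    {z : ClosedDisc} (hz : z ∈ openDisc) : CBar.fin (finitePart f z) = f z := by
  obtain ⟨w, hw⟩ := hf.mem_range_fin hz
  rw [finitePart_coe, ← hw, CBar.toComplex_fin]

theorem IsFiniteType.image_openDisc {f : C(ClosedDisc, CBar)} (hf : IsFiniteType f) :
    f '' openDisc = CBar.fin '' (finitePart f '' ball 0 1) := by
  rw [← coe_image_openDisc, image_image, image_image]
  exact image_congr fun z hz => (hf.fin_finitePart hz).symm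

theorem continuousAt_toComplex_eval {f : ABar} {z : ClosedDisc} (hz : f.1 z ∈ range CBar.fin) :
    ContinuousAt (fun p : ABar × ClosedDisc => (p.1.1 p.2).toComplex) (f, z) := by
  have heval : Continuous fun p : ABar × ClosedDisc => p.1.1 p.2 := by fun_prop
  exact (CBar.continuousAt_toComplex hz).comp_of_eq heval.continuousAt rfl

theorem tendstoLocallyUniformlyOn_finitePart {ι : Type*} {l : Filter ι} {h : ι → ABar} {f : ABar}
    (hf : IsFiniteType f.1) (hlim : Tendsto h l (𝓝 f)) :
    TendstoLocallyUniformlyOn (fun i => finitePart (h i).1) (finitePart f.1) l (ball 0 1) := by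
  rw [tendstoLocallyUniformlyOn_iff_forall_tendsto]
  intro z hz
  have hjoint : Tendsto (fun p : ι × ℂ => finitePart (h p.1).1 p.2) (l ×ˢ 𝓝[closedBall 0 1] z)
      (𝓝 (finitePart f.1 z)) := by
    lift z to ClosedDisc using ball_subset_closedBall hz
    rw [nhdsWithin_eq_map_subtype_coe z.2, prod_map_right, tendsto_map'_iff, finitePart_coe]
    have heval := continuousAt_toComplex_eval (hf.mem_range_fin (mem_openDisc_iff.2 hz))
    simpa [Function.comp_def, finitePart_coe] using
      heval.tendsto.comp ((hlim.comp tendsto_fst).prodMk_nhds tendsto_snd)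
  have hcont : Tendsto (finitePart f.1) (𝓝[ball 0 1] z) (𝓝 (finitePart f.1 z)) :=
    hf.differentiableOn_finitePart.continuousOn z hz
  refine ((hcont.comp tendsto_snd).prodMk_nhds (hjoint.mono_left ?_)).mono_right
    (nhds_le_uniformity _)
  exact prod_mono_right _ (nhdsWithin_mono z ball_subset_closedBall)

theorem IsFiniteType.eventually_mem_image_openDisc {f : ABar} (hf : IsFiniteType f.1)
    (hf_nontrivial : (f.1 '' openDisc).Nontrivial) {ζ : ClosedDisc}
    (hζ : f.1 ζ ∈ f.1 '' openDisc) :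
    ∀ᶠ p : ABar × ClosedDisc in 𝓝 (f, ζ), p.1.1 p.2 ∈ p.1.1 '' openDisc := by
  obtain ⟨z₀, hz₀, hz₀ζ⟩ := hζ
  obtain ⟨_, ⟨x, hx, rfl⟩, hxz₀⟩ := hf_nontrivial.exists_ne (f.1 z₀)
  have hne : finitePart f.1 x ≠ finitePart f.1 z₀ := fun heq => hxz₀ <| by
    rw [← hf.fin_finitePart hx, heq, hf.fin_finitePart hz₀]
  have hζ_fin : f.1 ζ ∈ range CBar.fin := hz₀ζ ▸ hf.mem_range_fin hz₀
  have hlim : Tendsto (fun p : ABar × ClosedDisc => (p.1.1 p.2).toComplex) (𝓝 (f, ζ))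
      (𝓝 (finitePart f.1 z₀)) := by
    rw [finitePart_coe, hz₀ζ]
    exact continuousAt_toComplex_eval hζ_fin
  have hfinite : ∀ᶠ p : ABar × ClosedDisc in 𝓝 (f, ζ), p.1.1 p.2 ∈ range CBar.fin :=
    (CBar.isOpen_range_fin.preimage (by fun_prop)).mem_nhds hζ_fin
  have htype : ∀ᶠ p : ABar × ClosedDisc in 𝓝 (f, ζ), IsFiniteType p.1.1 :=
    (isOpen_isFiniteType.preimage continuous_fst).mem_nhds hf
  have hattained : ∀ᶠ p : ABar × ClosedDisc in 𝓝 (f, ζ),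
      (p.1.1 p.2).toComplex ∈ finitePart p.1.1 '' ball 0 1 :=
    eventually_mem_image_of_tendstoLocallyUniformlyOn isOpen_ball
      (convex_ball 0 1).isPreconnected
      (tendstoLocallyUniformlyOn_finitePart hf (continuous_fst.tendsto (f, ζ)))
      (htype.mono fun p hp => hp.differentiableOn_finitePart) (mem_openDisc_iff.1 hx)
      (mem_openDisc_iff.1 hz₀) hne hlim
  filter_upwards [hfinite, htype, hattained] with p hp_finite hp_type hp_mem
  obtain ⟨w, hw⟩ := hp_finite
  rw [← hw, CBar.toComplex_fin] at hp_mem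
  rw [hp_type.image_openDisc, ← hw]
  exact mem_image_of_mem _ hp_mem

theorem isOpen_nontrivial_image (S : Set ClosedDisc) :
    IsOpen {f : ABar | (f.1 '' S).Nontrivial} := by
  have hunion : {f : ABar | (f.1 '' S).Nontrivial} =
      ⋃ x ∈ S, ⋃ y ∈ S, {f : ABar | f.1 x ≠ f.1 y} := by
    ext f
    simp [Set.Nontrivial]
  rw [hunion]
  exact isOpen_biUnion fun x _ => isOpen_biUnion fun y _ =>
    isOpen_ne_fun (by fun_prop) (by fun_prop)

end AttainedValues

section ExceptionalSet

theorem exceptionalSet_subset_iff {f : C(ClosedDisc, CBar)} {U : Set ℂ} :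
    exceptionalSet f ⊆ U ↔ ∀ ζ ∈ unitCircle, (ζ : ℂ) ∉ U → f ζ ∈ f '' openDisc := by
  rw [exceptionalSet, image_subset_iff]
  exact ⟨fun h ζ hζ hζU => by_contra fun hζf => hζU (h ⟨hζ, hζf⟩),
    fun h ζ hζ => by_contra fun hζU => hζ.2 (h ζ hζ.1 hζU)⟩

theorem exceptionalSet_eq_empty_of_subsingleton {f : C(ClosedDisc, CBar)}
    (hf : (f '' openDisc).Subsingleton) : exceptionalSet f = ∅ := by
  rw [← subset_empty_iff, exceptionalSet_subset_iff]
  intro ζ _ _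
  rw [← hf.isClosed.closure_eq]
  exact image_closure_subset_closure_image f.continuous
    ⟨ζ, dense_openDisc ζ, rfl⟩

/-- The nonconstant functions of finite type whose exceptional set is contained in an open set of
`1 / n`-content at most `1 / n`. -/
def smallExceptionalSet (m : ℝ≥0∞ → ℝ≥0∞) (n : ℕ) : Set ABar :=
  {f | IsFiniteType f.1 ∧ (f.1 '' openDisc).Nontrivial ∧ ∃ U : Set ℂ, IsOpen U ∧
    exceptionalSet f.1 ⊆ U ∧ gaugeContent m (n : ℝ≥0∞)⁻¹ U ≤ (n : ℝ≥0∞)⁻¹}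

theorem infinite_sphere {E : Type*} [NormedAddCommGroup E] [NormedSpace ℝ E]
    (hE : 1 < Module.rank ℝ E) (x : E) {r : ℝ} (hr : 0 < r) : (sphere x r).Infinite := by
  have : Nontrivial E := (rank_pos_iff_nontrivial (R := ℝ)).1 (one_pos.trans hE)
  obtain ⟨y, hy⟩ := (NormedSpace.sphere_nonempty (x := x)).2 hr.le
  refine (isPreconnected_sphere hE x r).infinite_of_nontrivial
    ⟨y, hy, Equiv.pointReflection x y, ?_, fun h => ne_of_mem_sphere hy hr.ne' ?_⟩
  · rw [mem_sphere, dist_pointReflection_left, dist_comm, hy]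
  · exact (AffineEquiv.pointReflection_fixed_iff_of_module ℝ).1 h.symm

theorem isClosed_unitCircle : IsClosed unitCircle :=
  isClosed_eq continuous_subtype_val.norm continuous_const

theorem isOpen_smallExceptionalSet (m : ℝ≥0∞ → ℝ≥0∞) (n : ℕ) :
    IsOpen (smallExceptionalSet m n) := by
  rw [isOpen_iff_mem_nhds]
  rintro f ⟨hf, hf_nontrivial, U, hU, hfU, hUn⟩
  have hcompact : IsCompact (unitCircle ∩ (↑) ⁻¹' Uᶜ) :=
    (isClosed_unitCircle.inter (hU.isClosed_compl.preimage continuous_subtype_val)).isCompact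
  have hattained : ∀ᶠ h : ABar in 𝓝 f, ∀ ζ ∈ unitCircle ∩ (↑) ⁻¹' Uᶜ, h.1 ζ ∈ h.1 '' openDisc :=
    hcompact.eventually_forall_of_forall_eventually fun ζ hζ =>
      hf.eventually_mem_image_openDisc hf_nontrivial
        (exceptionalSet_subset_iff.1 hfU ζ hζ.1 hζ.2)
  filter_upwards [hattained, isOpen_isFiniteType.mem_nhds hf,
    (isOpen_nontrivial_image openDisc).mem_nhds hf_nontrivial] with h hh hh_type hh_nontrivial
  exact ⟨hh_type, hh_nontrivial, U, hU,
    exceptionalSet_subset_iff.2 fun ζ hζ hζU => hh ζ ⟨hζ, hζU⟩, hUn⟩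

namespace discAlgebra

theorem image_openDisc_toABar {Q : ℂ → ℂ} (hQ : DiffContOnCl ℂ Q (ball 0 1)) :
    (toABar (ofDiffContOnCl Q hQ)).1 '' openDisc = CBar.fin '' (Q '' ball 0 1) := by
  rw [← coe_image_openDisc, image_image, image_image]
  rfl

theorem exists_dist_le_exceptionalSet_subset (p : discAlgebra) {ε : ℝ} (hε : 0 < ε) :
    ∃ t : Finset ℂ, ∀ U ∈ 𝓝ˢ (t : Set ℂ), ∃ q : discAlgebra, dist q p ≤ ε ∧
      ((toABar q).1 '' openDisc).Nontrivial ∧ exceptionalSet (toABar q).1 ⊆ U := by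
  obtain ⟨t, ht⟩ := exists_perturbation_mem_interior_image (diffContOnCl_discExtend p) hε
  refine ⟨t, fun U hU => ?_⟩
  -- Keeping `ζ₀` out of the neighbourhood forces the perturbed function to be nonconstant.
  have hsphere : (sphere (0 : ℂ) 1).Infinite :=
    infinite_sphere (by simp [Complex.rank_real_complex]) 0 one_pos
  obtain ⟨ζ₀, hζ₀, hζ₀t⟩ : ((sphere (0 : ℂ) 1) \ t).Nonempty :=
    (hsphere.sdiff t.finite_toSet).nonempty
  have hU' : U \ {ζ₀} ∈ 𝓝ˢ (t : Set ℂ) :=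
    inter_mem hU (isOpen_compl_singleton.mem_nhdsSet.2 (subset_compl_singleton_iff.2 hζ₀t))
  obtain ⟨Q, hQ, hQp, hQ_interior⟩ := ht _ hU'
  refine ⟨ofDiffContOnCl Q hQ, ?_, ?_, ?_⟩
  · refine (ContinuousMap.dist_le hε.le).2 fun z => ?_
    rw [dist_eq_norm, ofDiffContOnCl_apply, ← discExtend_coe p.1 z]
    exact hQp z z.2
  · rw [image_openDisc_toABar]
    have hmem : Q '' ball 0 1 ∈ 𝓝 (Q ζ₀) :=
      mem_interior_iff_mem_nhds.1 (hQ_interior ζ₀ hζ₀ (by simp))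
    exact (infinite_of_mem_nhds _ hmem).nontrivial.image CBar.fin_injective
  · refine exceptionalSet_subset_iff.2 fun ζ hζ hζU => ?_
    rw [image_openDisc_toABar, toABar_apply, ofDiffContOnCl_apply]
    refine mem_image_of_mem _ (interior_subset (hQ_interior ζ (mem_sphere_zero_iff_norm.2 hζ) ?_))
    exact fun hmem => hζU hmem.1

end discAlgebra

theorem dense_preimage_smallExceptionalSet {m : ℝ≥0∞ → ℝ≥0∞} (hmono : MonotoneOn m (Iio ⊤))
    (hcont : ∀ t < ⊤, ContinuousWithinAt m (Ici t) t) (hm : m 0 = 0) (n : ℕ) :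
    Dense (discAlgebra.toABar ⁻¹' smallExceptionalSet m n) := by
  refine Metric.dense_iff.2 fun p ε hε => ?_
  obtain ⟨t, ht⟩ := discAlgebra.exists_dist_le_exceptionalSet_subset p (half_pos hε)
  obtain ⟨U, hU, htU, hUn⟩ :=
    (mkMetric_eq_zero_iff_exists_isOpen hmono hcont).1 (mkMetric_finset_eq_zero hm t) n
  obtain ⟨q, hqp, hq_nontrivial, hqU⟩ := ht U (hU.mem_nhdsSet.2 htU)
  exact ⟨q, hqp.trans_lt (half_lt_self hε), discAlgebra.isFiniteType_toABar q, hq_nontrivial,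
    U, hU, hqU, hUn⟩

/-- The functions of finite type that are constant on the open disc. -/
def finiteConstants : Set ABar := {f | IsFiniteType f.1 ∧ (f.1 '' openDisc).Subsingleton}

theorem isGδ_finiteConstants : IsGδ finiteConstants := by
  have hclosed : IsClosed {f : ABar | (f.1 '' openDisc).Subsingleton} := by
    simpa only [← isOpen_compl_iff, compl_ofPred, not_subsingleton_iff] using
      isOpen_nontrivial_image openDisc
  exact isOpen_isFiniteType.isGδ.inter hclosed.isGδ

theorem setOf_mkMetric_exceptionalSet_eq_zero {m : ℝ≥0∞ → ℝ≥0∞} (hmono : MonotoneOn m (Iio ⊤))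
    (hcont : ∀ t < ⊤, ContinuousWithinAt m (Ici t) t) :
    {f : ABar | IsFiniteType f.1 ∧ Measure.mkMetric m (exceptionalSet f.1) = 0} =
      (⋂ n, smallExceptionalSet m n) ∪ finiteConstants := by
  ext f
  rcases (f.1 '' openDisc).subsingleton_or_nontrivial with hf | hf
  · simp [smallExceptionalSet, finiteConstants, exceptionalSet_eq_empty_of_subsingleton hf, hf,
      not_nontrivial_iff.2 hf]
  · simp [smallExceptionalSet, finiteConstants, hf, not_subsingleton_iff.2 hf, forall_and,
      mkMetric_eq_zero_iff_exists_isOpen hmono hcont]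

end ExceptionalSet

namespace IsHausdorffMeasureFunction

variable {η : ℝ≥0 → ℝ≥0}

theorem monotoneOn_gauge (hη : IsHausdorffMeasureFunction η) :
    MonotoneOn (fun t : ℝ≥0∞ => (η t.toNNReal : ℝ≥0∞)) (Iio ⊤) := by
  intro s _ t ht hst
  exact ENNReal.coe_le_coe.2 (hη.monotone (ENNReal.toNNReal_mono (ne_of_lt ht) hst))

theorem continuousWithinAt_gauge (hη : IsHausdorffMeasureFunction η) {t : ℝ≥0∞} (ht : t < ⊤) :
    ContinuousWithinAt (fun t : ℝ≥0∞ => (η t.toNNReal : ℝ≥0∞)) (Ici t) t := by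
  have hlim : Tendsto ENNReal.toNNReal (𝓝[≥] t) (𝓝[≥] t.toNNReal) := by
    refine tendsto_nhdsWithin_iff.2
      ⟨(ENNReal.tendsto_toNNReal ht.ne).mono_left nhdsWithin_le_nhds, ?_⟩
    filter_upwards [self_mem_nhdsWithin, nhdsWithin_le_nhds (Iio_mem_nhds ht)] with s hts hs
    exact ENNReal.toNNReal_mono hs.ne hts
  exact (ENNReal.continuous_coe.tendsto _).comp ((hη.rightContinuous _).tendsto.comp hlim)

end IsHausdorffMeasureFunction

end ExtDisc

theorem proposition5p3 (η : NNReal → NNReal) (hη : ExtDisc.IsHausdorffMeasureFunction η) :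
    Dense {f : ExtDisc.ABar | ExtDisc.IsFiniteType f.1 ∧
      ExtDisc.hausdorffMeasureOf η (ExtDisc.exceptionalSet f.1) = 0} ∧
    IsGδ {f : ExtDisc.ABar | ExtDisc.IsFiniteType f.1 ∧
      ExtDisc.hausdorffMeasureOf η (ExtDisc.exceptionalSet f.1) = 0} := by
  open ExtDisc in
  have hcont := fun t ht => hη.continuousWithinAt_gauge (t := t) ht
  simp only [hausdorffMeasureOf, setOf_mkMetric_exceptionalSet_eq_zero hη.monotoneOn_gauge hcont]
  have hopen := isOpen_smallExceptionalSet fun t : ℝ≥0∞ => (η t.toNNReal : ℝ≥0∞)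
  refine ⟨?_, (IsGδ.iInter_of_isOpen hopen).union isGδ_finiteConstants⟩
  have hdense : Dense (⋂ n, discAlgebra.toABar ⁻¹'
      smallExceptionalSet (fun t : ℝ≥0∞ => (η t.toNNReal : ℝ≥0∞)) n) :=
    dense_iInter_of_isOpen (fun n => (hopen n).preimage discAlgebra.continuous_toABar)
      (dense_preimage_smallExceptionalSet hη.monotoneOn_gauge hcont (by simp [hη.zero]))
  exact denseRange_toABar.dense_of_mapsTo discAlgebra.continuous_toABar hdense fun p hp =>
    Or.inl (by simpa using hp)
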